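/- Let $H, K, R$ be complex Hilbert spaces. A nest on a Hilbert space is a set of orthogonal projections that is totally ordered, contains $0$ and the identity, and is closed under arbitrary intersections and closed spans (of ranges). Let $\mathcal N, \mathcal M, \mathcal L$ be nests on $H, K, R$ respectively. A continuous onto nest homomorphism between two nests is an order-preserving surjective map which is continuous for the weak operator topologies. For such a map $\phi:\mathcal N\to\mathcal M$ put $$Op(\phi)=\{y\in\mathbb B(H,K)\mid (I_K-\phi(p))\,y\,p=0 \text{ for all } p\in\mathcal N\},$$ and similarly for maps between other nests. Let $\phi:\mathcal N\to\mathcal M$, $\zeta:\mathcal N\to\mathcal L$ and $\theta:\mathcal M\to\mathcal L$ be continuous onto nest homomorphisms. Then the following are equivalent: (i) $\zeta=\theta\circ\phi$; (ii) $Op(\zeta)$ is the closure, in the w*-topology (ultraweak topology) of $\mathbb B(H,R)$, of the linear span of $\{x\,y\mid x\in Op(\theta),\ y\in Op(\phi)\}$. -/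

import Mathlib

open scoped InnerProductSpace Topology

noncomputable section

/-- A nest on a complex Hilbert space: a totally ordered set of (orthogonal) projections that
contains `0` and the identity and is closed under arbitrary intersections and closed spans
(of the ranges). -/
structure IsNest {H : Type*} [NormedAddCommGroup H] [InnerProductSpace ℂ H] [CompleteSpace H]
    (N : Set (H →L[ℂ] H)) : Prop where
  isStarProjection : ∀ p ∈ N, IsStarProjection p
  zero_mem : (0 : H →L[ℂ] H) ∈ N
  one_mem : (1 : H →L[ℂ] H) ∈ N
  total : ∀ p ∈ N, ∀ q ∈ N, p ≤ q ∨ q ≤ p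
  inter_mem : ∀ S : Set (H →L[ℂ] H), S ⊆ N →
    ∃ p ∈ N, (p : H →ₗ[ℂ] H).range = ⨅ q ∈ S, (q : H →ₗ[ℂ] H).range
  closedSpan_mem : ∀ S : Set (H →L[ℂ] H), S ⊆ N →
    ∃ p ∈ N, (p : H →ₗ[ℂ] H).range = (⨆ q ∈ S, (q : H →ₗ[ℂ] H).range).topologicalClosure

/-- The weak operator topology on a set of bounded operators. -/
abbrev wotOn {H : Type*} [NormedAddCommGroup H] [InnerProductSpace ℂ H]
    (N : Set (H →L[ℂ] H)) : TopologicalSpace N :=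
  TopologicalSpace.induced
    (fun p : N => (ContinuousLinearMapWOT.ofCLM (p : H →L[ℂ] H) : H →WOT[ℂ] H)) inferInstance

/-- A continuous onto nest homomorphism: an order preserving surjection that is continuous for
the weak operator topologies. -/
structure IsContOntoNestHom {H K : Type*}
    [NormedAddCommGroup H] [InnerProductSpace ℂ H]
    [NormedAddCommGroup K] [InnerProductSpace ℂ K]
    {N : Set (H →L[ℂ] H)} {M : Set (K →L[ℂ] K)} (φ : N → M) : Prop where
  monotone : Monotone φ
  continuous : Continuous[wotOn N, wotOn M] φ
  surjective : Function.Surjective φ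

/-- `Op(φ) = {y ∈ B(H, K) | φ(p)^⊥ y p = 0 for all p ∈ N}`, where `q^⊥ = 1 - q`. -/
def Op {H K : Type*}
    [NormedAddCommGroup H] [InnerProductSpace ℂ H]
    [NormedAddCommGroup K] [InnerProductSpace ℂ K]
    {N : Set (H →L[ℂ] H)} {M : Set (K →L[ℂ] K)} (φ : N → M) : Set (H →L[ℂ] K) :=
  {y | ∀ p : N, (1 - (φ p : K →L[ℂ] K)) ∘L y ∘L (p : H →L[ℂ] H) = 0}

/-- The `w*`-topology (ultraweak topology) of `B(H, K)`, as the dual of the trace class operators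
from `K` to `H`: the initial topology for the functionals `T ↦ ∑ₙ ⟪ηₙ, T ξₙ⟫` with
`∑ₙ ‖ξₙ‖² < ∞` and `∑ₙ ‖ηₙ‖² < ∞`. -/
abbrev wStarTopology (H K : Type*)
    [NormedAddCommGroup H] [InnerProductSpace ℂ H]
    [NormedAddCommGroup K] [InnerProductSpace ℂ K] : TopologicalSpace (H →L[ℂ] K) :=
  ⨅ (ξ : ℕ → H) (η : ℕ → K) (_ : Summable fun n => ‖ξ n‖ ^ 2) (_ : Summable fun n => ‖η n‖ ^ 2),
    TopologicalSpace.induced (fun T : H →L[ℂ] K => ∑' n, ⟪η n, T (ξ n)⟫_ℂ) inferInstance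

/-- The series defining the functionals of the `w*`-topology converge. -/
theorem summable_wStar_functional {H K : Type*}
    [NormedAddCommGroup H] [InnerProductSpace ℂ H]
    [NormedAddCommGroup K] [InnerProductSpace ℂ K] {ξ : ℕ → H} {η : ℕ → K}
    (hξ : Summable fun n => ‖ξ n‖ ^ 2) (hη : Summable fun n => ‖η n‖ ^ 2) (T : H →L[ℂ] K) :
    Summable fun n => ⟪η n, T (ξ n)⟫_ℂ := by
  refine Summable.of_norm_bounded ((hη.add hξ).mul_left ‖T‖) fun n => ?_
  have h1 := norm_inner_le_norm (𝕜 := ℂ) (η n) (T (ξ n))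
  have h2 : ‖η n‖ * ‖T (ξ n)‖ ≤ ‖η n‖ * (‖T‖ * ‖ξ n‖) :=
    mul_le_mul_of_nonneg_left (T.le_opNorm _) (norm_nonneg _)
  have h3 : ‖η n‖ * ‖ξ n‖ ≤ ‖η n‖ ^ 2 + ‖ξ n‖ ^ 2 := by
    nlinarith [sq_nonneg (‖η n‖ - ‖ξ n‖), sq_nonneg ‖η n‖, sq_nonneg ‖ξ n‖]
  have h4 := mul_le_mul_of_nonneg_left h3 (norm_nonneg T)
  linarith

/-- The `w*`-closure of the linear span of `{y x | x ∈ X, y ∈ Y}`. -/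
def wStarClosedSpanMul {H K R : Type*}
    [NormedAddCommGroup H] [InnerProductSpace ℂ H]
    [NormedAddCommGroup K] [InnerProductSpace ℂ K]
    [NormedAddCommGroup R] [InnerProductSpace ℂ R]
    (Y : Set (K →L[ℂ] R)) (X : Set (H →L[ℂ] K)) : Set (H →L[ℂ] R) :=
  closure[wStarTopology H R]
    (Submodule.span ℂ {z : H →L[ℂ] R | ∃ y ∈ Y, ∃ x ∈ X, z = y ∘L x} : Set (H →L[ℂ] R))

end

/-! ### Nests: order structure, strong limits, induction -/

namespace IsNest

variable {H : Type*} [NormedAddCommGroup H] [InnerProductSpace ℂ H] [CompleteSpace H]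
  {N : Set (H →L[ℂ] H)}

/-! Two facts give the equivalence: `Op` determines a continuous onto homomorphism (`Op_injective`),
and `Op (θ ∘ φ)` is always the w*-closed span of the products (`Op_comp_eq`).

Both rest on rank one operators. By continuity, a vector of ran φ(p), p ≠ 0, is a norm limit of
vectors w for which some p' < p has w ∈ ran φ(r) whenever r is not below p'. Then w⊗u ∈ Op(φ) for
every u killed by p', and u may be chosen nonzero in ran p. Such operators separate homomorphisms.
Composing two of them through a common vector of K shows that the norm-closed span of the products
contains enough rank one operators (`rankOne_mem_closure_span`).

For density, let T ∈ Op(θ∘φ) and let a functional A ↦ ⟪η, (A⊗1)ξ⟫ kill the products. It kills (Tv)⊗u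
for suitable rank one v⊗u in the nest algebra of N, so the functional of the pair (ξ, T*η) kills
those v⊗u. It must then kill the identity, by an Erdos-type density argument. The diagonal blocks of
the functional along short intervals of the nest are controlled by increments of a decreasing chain
of subspaces of ℓ². These increments telescope, so the total is arbitrarily small
(`norm_inner_le_of_forall_inner_innerCoeff_eq_zero`). -/

theorem apply_of_le (hN : IsNest N) {p q : N} (h : p ≤ q) (x : H) : q.1 (p.1 x) = p.1 x :=
  DFunLike.congr_fun (((hN.isStarProjection _ p.2).le_iff_mul_eq_right
    (hN.isStarProjection _ q.2)).1 h) x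

theorem apply_of_le' (hN : IsNest N) {p q : N} (h : p ≤ q) (x : H) : p.1 (q.1 x) = p.1 x :=
  DFunLike.congr_fun (((hN.isStarProjection _ p.2).le_iff_mul_eq_left
    (hN.isStarProjection _ q.2)).1 h) x

theorem apply_apply (hN : IsNest N) (p : N) (x : H) : p.1 (p.1 x) = p.1 x :=
  hN.apply_of_le le_rfl x

theorem le_of_fixed (hN : IsNest N) {p q : N} (h : ∀ x, p.1 x = x → q.1 x = x) : p ≤ q :=
  ((hN.isStarProjection _ p.2).le_iff_mul_eq_right (hN.isStarProjection _ q.2)).2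
    (ContinuousLinearMap.ext fun x => h _ (hN.apply_apply p x))

theorem fixed_of_le (hN : IsNest N) {p q : N} (h : p ≤ q) {x : H} (hx : p.1 x = x) :
    q.1 x = x := by
  rw [← hx, hN.apply_of_le h]

theorem eq_zero_of_le (hN : IsNest N) {p q : N} (h : p ≤ q) {x : H} (hx : q.1 x = 0) :
    p.1 x = 0 := by
  rw [← hN.apply_of_le' h, hx, map_zero]

theorem le_total (hN : IsNest N) (p q : N) : p ≤ q ∨ q ≤ p := hN.total _ p.2 _ q.2

theorem lt_of_not_ge (hN : IsNest N) {p q : N} (h : ¬ p ≤ q) : q < p :=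
  lt_of_le_not_ge ((hN.le_total p q).resolve_left h) h

theorem inner_apply (hN : IsNest N) (p : N) (x y : H) : ⟪p.1 x, y⟫_ℂ = ⟪x, p.1 y⟫_ℂ := by
  rw [← ContinuousLinearMap.adjoint_inner_right,
    show ContinuousLinearMap.adjoint p.1 = p.1 from (hN.isStarProjection _ p.2).isSelfAdjoint]

theorem norm_apply_le (hN : IsNest N) (p : N) (x : H) : ‖p.1 x‖ ≤ ‖x‖ := by
  simpa using p.1.le_of_opNorm_le (hN.isStarProjection _ p.2).norm_le x

theorem norm_sub_apply_le (hN : IsNest N) (p : N) (x : H) : ‖x - p.1 x‖ ≤ ‖x‖ := by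
  simpa using (1 - p.1).le_of_opNorm_le (hN.isStarProjection _ p.2).one_sub.norm_le x

theorem mem_range_iff (hN : IsNest N) (p : N) {x : H} :
    x ∈ (p.1 : H →ₗ[ℂ] H).range ↔ p.1 x = x :=
  ⟨by rintro ⟨y, rfl⟩; exact hN.apply_apply p y, fun h => ⟨x, h⟩⟩

/-- The zero projection of a nest. -/
def bot (hN : IsNest N) : N := ⟨0, hN.zero_mem⟩

/-- The identity in a nest. -/
def top (hN : IsNest N) : N := ⟨1, hN.one_mem⟩

theorem bot_le (hN : IsNest N) (p : N) : hN.bot ≤ p :=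
  hN.le_of_fixed fun x hx => by
    have : (0 : H) = x := hx
    simp [← this]

theorem le_top (hN : IsNest N) (p : N) : p ≤ hN.top := hN.le_of_fixed fun _ _ => rfl

/-- Suprema in a nest exist, and are strong limits. -/
theorem exists_isLUB (hN : IsNest N) (S : Set N) : ∃ s : N, IsLUB S s ∧
    (S.Nonempty → ∀ x, ∀ δ > 0, ∃ p ∈ S, ‖s.1 x - p.1 x‖ < δ) := by
  obtain ⟨s, hs, hr⟩ := hN.closedSpan_mem (Subtype.val '' S) (by rintro _ ⟨p, -, rfl⟩; exact p.2)
  rw [iSup_image] at hr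
  lift s to N using hs
  refine ⟨s, ⟨fun p hp => hN.le_of_fixed fun x hx => ?_, fun t ht => hN.le_of_fixed fun x hx => ?_⟩,
    fun hS x δ hδ => ?_⟩
  · rw [← hN.mem_range_iff, hr]
    refine Submodule.le_topologicalClosure _ (Submodule.mem_iSup_of_mem p
      (Submodule.mem_iSup_of_mem hp ((hN.mem_range_iff p).2 hx)))
  · rw [← hN.mem_range_iff, hr] at hx
    refine (Submodule.topologicalClosure_minimal (t := (t.1 - 1 : H →L[ℂ] H).ker) _ ?_
      (t.1 - 1 : H →L[ℂ] H).isClosed_ker hx : x ∈ _) |> fun h => sub_eq_zero.1 h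
    refine iSup₂_le fun p hp y hy => sub_eq_zero.2 ?_
    exact hN.fixed_of_le (ht hp) ((hN.mem_range_iff p).1 hy)
  · have hx : s.1 x ∈ (s.1 : H →ₗ[ℂ] H).range := ⟨x, rfl⟩
    rw [hr] at hx
    obtain ⟨y, hy, hxy⟩ := Metric.mem_closure_iff.1 hx δ hδ
    rw [dist_eq_norm] at hxy
    replace hy : y ∈ ⨆ p ∈ S, (p.1 : H →ₗ[ℂ] H).range := hy
    -- The ranges form a chain, so the approximant y already lies in a single ran p; then s x - p x
    -- = (1 - p)(s x - y).
    rw [← sSup_image, Submodule.mem_sSup_of_directed (hS.image _)] at hy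
    · obtain ⟨_, ⟨p, hp, rfl⟩, hy⟩ := hy
      refine ⟨p, hp, ?_⟩
      have hps : p ≤ s := hN.le_of_fixed fun z hz => by
        rw [← hN.mem_range_iff, hr]
        exact Submodule.le_topologicalClosure _ (Submodule.mem_iSup_of_mem p
          (Submodule.mem_iSup_of_mem hp ((hN.mem_range_iff p).2 hz)))
      have := hN.norm_sub_apply_le p (s.1 x - y)
      rw [map_sub, (hN.mem_range_iff p).1 hy, hN.apply_of_le' hps] at this
      calc _ = ‖s.1 x - y - (p.1 x - y)‖ := by congr 1; abel
        _ ≤ _ := this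
        _ < δ := hxy
    · rintro _ ⟨p, hp, rfl⟩ _ ⟨q, hq, rfl⟩
      rcases hN.le_total p q with h | h
      · refine ⟨_, ⟨q, hq, rfl⟩, fun z hz => ?_, le_rfl⟩
        exact (hN.mem_range_iff q).2 (hN.fixed_of_le h ((hN.mem_range_iff p).1 hz))
      · refine ⟨_, ⟨p, hp, rfl⟩, le_rfl, fun z hz => ?_⟩
        exact (hN.mem_range_iff p).2 (hN.fixed_of_le h ((hN.mem_range_iff q).1 hz))

/-- Infima in a nest exist, and are strong limits. -/
theorem exists_isGLB (hN : IsNest N) (S : Set N) : ∃ s : N, IsGLB S s ∧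
    (S.Nonempty → ∀ x, ∀ δ > 0, ∃ p ∈ S, ‖p.1 x - s.1 x‖ < δ) := by
  obtain ⟨s, hs, hr⟩ := hN.inter_mem (Subtype.val '' S) (by rintro _ ⟨p, -, rfl⟩; exact p.2)
  rw [iInf_image] at hr
  lift s to N using hs
  have hfix : ∀ x, s.1 x = x ↔ ∀ p ∈ S, p.1 x = x := fun x => by
    rw [← hN.mem_range_iff, hr]
    simp only [Submodule.mem_iInf]
    exact forall₂_congr fun p _ => hN.mem_range_iff p
  have hle : ∀ p ∈ S, s ≤ p := fun p hp => hN.le_of_fixed fun x hx => (hfix x).1 hx p hp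
  refine ⟨s, ⟨hle, fun t ht => hN.le_of_fixed fun x hx =>
    (hfix x).2 fun p hp => hN.fixed_of_le (ht hp) hx⟩, fun hS x δ hδ => ?_⟩
  set U : Submodule ℂ H := sSup ((fun p : N => (p.1 : H →ₗ[ℂ] H).ker) '' S) with hU
  -- A vector orthogonal to all the kernels is fixed by every member of S, hence by s.
  have hx : x - s.1 x ∈ U.topologicalClosure := by
    rw [← Submodule.orthogonal_orthogonal_eq_closure]
    intro y hy
    have hys : s.1 y = y := (hfix y).2 fun p hp => by
      have hk : y - p.1 y ∈ U := by
        have hpU : (p.1 : H →ₗ[ℂ] H).ker ≤ U := le_sSup ⟨p, hp, rfl⟩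
        exact hpU (by simp [hN.apply_apply])
      have h1 := hy _ hk
      have h2 : ⟪y - p.1 y, p.1 y⟫_ℂ = 0 := by
        rw [← hN.inner_apply, map_sub, hN.apply_apply, sub_self, inner_zero_left]
      have h3 : ⟪y - p.1 y, y - p.1 y⟫_ℂ = 0 := by rw [inner_sub_right, h1, h2, sub_zero]
      exact (sub_eq_zero.1 (inner_self_eq_zero.1 h3)).symm
    rw [inner_sub_right, ← hN.inner_apply, hys, sub_self]
  obtain ⟨y, hy, hxy⟩ := Metric.mem_closure_iff.1 hx δ hδ
  rw [dist_eq_norm] at hxy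
  replace hy : y ∈ U := hy
  rw [hU, Submodule.mem_sSup_of_directed (hS.image _)] at hy
  · obtain ⟨_, ⟨p, hp, rfl⟩, hy⟩ := hy
    refine ⟨p, hp, ?_⟩
    have hy0 : p.1 y = 0 := hy
    have := hN.norm_apply_le p (x - s.1 x - y)
    rw [map_sub, map_sub, hy0, hN.apply_of_le (hle p hp), sub_zero] at this
    exact this.trans_lt hxy
  · rintro _ ⟨p, hp, rfl⟩ _ ⟨q, hq, rfl⟩
    rcases hN.le_total p q with h | h
    · exact ⟨_, ⟨p, hp, rfl⟩, le_rfl, fun z hz => hN.eq_zero_of_le h hz⟩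
    · exact ⟨_, ⟨q, hq, rfl⟩, fun z hz => hN.eq_zero_of_le h hz, le_rfl⟩

/-- The inner difference is (1 - p') q' applied to the outer one, and both factors are contractions.
-/
theorem norm_sub_apply_mono (hN : IsNest N) {p p' q q' : N} (h : p ≤ p') (h' : p' ≤ q')
    (h'' : q' ≤ q) (x : H) : ‖q'.1 x - p'.1 x‖ ≤ ‖q.1 x - p.1 x‖ := by
  have h1 : q'.1 x - p'.1 x = q'.1 (q.1 x - p.1 x) - p'.1 (q'.1 (q.1 x - p.1 x)) := by
    rw [map_sub, hN.apply_of_le' h'', hN.apply_of_le (h.trans h'), map_sub, hN.apply_of_le' h',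
      hN.apply_of_le h]
    abel
  rw [h1]
  exact (hN.norm_sub_apply_le _ _).trans (hN.norm_apply_le _ _)

/-- In a chain, the larger of two good approximants is good for both, so strong approximation passes
from one vector to finitely many. -/
theorem exists_mem_forall_norm_lt_of_isLUB (hN : IsNest N) {S : Set N} (hS : S.Nonempty) {s : N}
    (hs : IsLUB S s) (A : Finset H) {δ : ℝ} (hδ : 0 < δ) :
    ∃ p ∈ S, ∀ x ∈ A, ‖s.1 x - p.1 x‖ < δ := by
  classical
  induction A using Finset.induction_on with
  | empty => exact hS.imp fun p hp => ⟨hp, by simp⟩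
  | insert a A _ ih =>
    obtain ⟨p, hp, hpA⟩ := ih
    obtain ⟨s', hs', h⟩ := hN.exists_isLUB S
    obtain rfl := hs.unique hs'
    obtain ⟨q, hq, hqa⟩ := h hS a δ hδ
    have key : ∀ r ∈ S, p ≤ r → q ≤ r → ∀ x ∈ insert a A, ‖s.1 x - r.1 x‖ < δ := by
      intro r hr hpr hqr x hx
      rcases Finset.mem_insert.1 hx with rfl | hx
      · exact (hN.norm_sub_apply_mono hqr (hs.1 hr) le_rfl _).trans_lt hqa
      · exact (hN.norm_sub_apply_mono hpr (hs.1 hr) le_rfl _).trans_lt (hpA x hx)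
    rcases hN.le_total p q with h | h
    · exact ⟨q, hq, key q hq h le_rfl⟩
    · exact ⟨p, hp, key p hp le_rfl h⟩

theorem exists_mem_forall_norm_lt_of_isGLB (hN : IsNest N) {S : Set N} (hS : S.Nonempty) {s : N}
    (hs : IsGLB S s) (A : Finset H) {δ : ℝ} (hδ : 0 < δ) :
    ∃ p ∈ S, ∀ x ∈ A, ‖p.1 x - s.1 x‖ < δ := by
  classical
  induction A using Finset.induction_on with
  | empty => exact hS.imp fun p hp => ⟨hp, by simp⟩
  | insert a A _ ih =>
    obtain ⟨p, hp, hpA⟩ := ih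
    obtain ⟨s', hs', h⟩ := hN.exists_isGLB S
    obtain rfl := hs.unique hs'
    obtain ⟨q, hq, hqa⟩ := h hS a δ hδ
    have key : ∀ r ∈ S, r ≤ p → r ≤ q → ∀ x ∈ insert a A, ‖r.1 x - s.1 x‖ < δ := by
      intro r hr hpr hqr x hx
      rcases Finset.mem_insert.1 hx with rfl | hx
      · exact (hN.norm_sub_apply_mono le_rfl (hs.1 hr) hqr _).trans_lt hqa
      · exact (hN.norm_sub_apply_mono le_rfl (hs.1 hr) hpr _).trans_lt (hpA x hx)
    rcases hN.le_total p q with h | h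
    · exact ⟨p, hp, key p hp le_rfl h⟩
    · exact ⟨q, hq, key q hq h le_rfl⟩

/-- Induction along a nest: a property of the members that holds at `0` and persists across gaps
and across intervals that are small on a given finite set of vectors holds at the identity. -/
theorem induction (hN : IsNest N) (A : Finset H) {δ : ℝ} (hδ : 0 < δ) {P : N → Prop}
    (h0 : P hN.bot)
    (step : ∀ p q : N, p ≤ q → P p →
      ((∀ r : N, r ≤ p ∨ q ≤ r) ∨ ∀ x ∈ A, ‖q.1 x - p.1 x‖ < δ) → P q) : P hN.top := by
  obtain ⟨s, hs, -⟩ := hN.exists_isLUB {p | P p}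
  have hPs : P s := by
    obtain ⟨p, hp, hpA⟩ := hN.exists_mem_forall_norm_lt_of_isLUB ⟨_, h0⟩ hs A hδ
    exact step p s (hs.1 hp) hp (.inr hpA)
  rcases (hN.le_top s).eq_or_lt with h | h
  · rwa [← h]
  exfalso
  obtain ⟨t, ht, -⟩ := hN.exists_isGLB {p | s < p}
  have hst : s ≤ t := ht.2 fun p hp => le_of_lt hp
  have hgap : ∀ r : N, r ≤ s ∨ t ≤ r := fun r =>
    or_iff_not_imp_left.2 fun hr => ht.1 (hN.lt_of_not_ge hr)
  -- Crossing the gap from s to t puts t among the members with P, so there is no gap and s is a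
  -- limit from above; a small step beyond s then contradicts maximality.
  have hts : t = s := (hs.1 (step s t hst hPs (.inl hgap))).antisymm hst
  subst hts
  obtain ⟨p, hp, hpA⟩ := hN.exists_mem_forall_norm_lt_of_isGLB ⟨_, h⟩ ht A hδ
  exact hp.not_ge (hs.1 (step t p hp.le hPs (.inr hpA)))

end IsNest

/-! ### Amplifications and coefficient vectors -/

section Amplification

variable {ι : Type*} {H K : Type*} [NormedAddCommGroup H] [InnerProductSpace ℂ H]
  [NormedAddCommGroup K] [InnerProductSpace ℂ K]

/-- The operator `T` applied to each entry of a square summable family. -/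
noncomputable def amplify (ι : Type*) (T : H →L[ℂ] K) :
    lp (fun _ : ι => H) 2 →L[ℂ] lp (fun _ : ι => K) 2 :=
  lp.mapCLM 2 (fun _ => T) (norm_nonneg T) (fun _ => le_rfl)

@[simp]
theorem amplify_apply (T : H →L[ℂ] K) (ξ : lp (fun _ : ι => H) 2) (i : ι) :
    amplify ι T ξ i = T (ξ i) := rfl

theorem amplify_sub (T S : H →L[ℂ] K) (ξ : lp (fun _ : ι => H) 2) :
    amplify ι (T - S) ξ = amplify ι T ξ - amplify ι S ξ := rfl

omit [InnerProductSpace ℂ H] in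
theorem lp.hasSum_norm_sq (ξ : lp (fun _ : ι => H) 2) :
    HasSum (fun i => ‖ξ i‖ ^ 2) (‖ξ‖ ^ 2) := by
  simpa using lp.hasSum_norm (by norm_num) ξ

/-- The conjugate coefficients of a square summable family of vectors in the direction `u`. -/
noncomputable def innerCoeff (ξ : lp (fun _ : ι => H) 2) :
    H →ₗ[ℂ] lp (fun _ : ι => ℂ) 2 where
  toFun u := ⟨fun i => ⟪ξ i, u⟫_ℂ, ((lp.memℓp ξ).norm.const_mul ‖u‖).mono fun i => by
    rw [mul_comm]; exact norm_inner_le_norm _ _⟩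
  map_add' u v := by ext i; exact inner_add_right _ _ _
  map_smul' c u := by ext i; exact inner_smul_right _ _ _

@[simp]
theorem innerCoeff_apply (ξ : lp (fun _ : ι => H) 2) (u : H) (i : ι) :
    innerCoeff ξ u i = ⟪ξ i, u⟫_ℂ := rfl

theorem inner_innerCoeff_innerCoeff (ξ η : lp (fun _ : ι => H) 2) (u v : H) :
    ⟪innerCoeff ξ u, innerCoeff η v⟫_ℂ = ∑' i, ⟪η i, v⟫_ℂ * ⟪u, ξ i⟫_ℂ := by
  simp [lp.inner_eq_tsum]

variable {κ : Type*} {V : Submodule ℂ H} [V.HasOrthogonalProjection]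

theorem HilbertBasis.hasSum_inner_mul_inner_starProjection (b : HilbertBasis κ ℂ V) (x y : H) :
    HasSum (fun k => ⟪x, (b k : H)⟫_ℂ * ⟪(b k : H), y⟫_ℂ) ⟪x, V.starProjection y⟫_ℂ := by
  have h := b.hasSum_inner_mul_inner (V.orthogonalProjectionOnto x) (V.orthogonalProjectionOnto y)
  have h1 : ⟪V.orthogonalProjectionOnto x, V.orthogonalProjectionOnto y⟫_ℂ =
      ⟪x, V.starProjection y⟫_ℂ := by
    rw [Submodule.coe_inner, ← Submodule.starProjection_apply, ← Submodule.starProjection_apply,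
      Submodule.inner_starProjection_left_eq_right,
      Submodule.starProjection_eq_self_iff.2 (V.starProjection_apply_mem y)]
  rw [h1] at h
  refine h.congr_fun fun k => ?_
  simp

theorem HilbertBasis.hasSum_norm_inner_sq (b : HilbertBasis κ ℂ V) (x : H) :
    HasSum (fun k => ‖⟪x, (b k : H)⟫_ℂ‖ ^ 2) (‖V.starProjection x‖ ^ 2) := by
  have h := Complex.hasSum_re (b.hasSum_inner_mul_inner_starProjection x x)
  convert h using 1
  · ext k
    rw [← inner_conj_symm (b k : H) x, Complex.mul_conj, Complex.normSq_eq_norm_sq]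
    norm_cast
  · rw [← V.inner_starProjection_left_eq_right]
    exact (V.re_inner_starProjection_eq_normSq x).symm

theorem HilbertBasis.summable_norm_inner_sq (b : HilbertBasis κ ℂ V)
    (ξ : lp (fun _ : ι => H) 2) :
    Summable fun a : ι × κ => ‖⟪ξ a.1, (b a.2 : H)⟫_ℂ‖ ^ 2 := by
  refine (summable_prod_of_nonneg fun _ => by positivity).2
    ⟨fun i => (b.hasSum_norm_inner_sq (ξ i)).summable, ?_⟩
  refine (lp.hasSum_norm_sq ξ).summable.of_nonneg_of_le (fun i => tsum_nonneg fun _ => by positivity)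
    fun i => ?_
  rw [(b.hasSum_norm_inner_sq (ξ i)).tsum_eq]
  gcongr
  exact V.norm_starProjection_apply_le _

/-- Parseval in V for each index of ι, followed by an exchange of the two sums, which square
summability makes absolutely convergent. It writes a block of the functional as a sum of inner
products in ℓ²(ι). -/
theorem HilbertBasis.hasSum_inner_innerCoeff (b : HilbertBasis κ ℂ V)
    (ξ η : lp (fun _ : ι => H) 2) :
    HasSum (fun k => ⟪innerCoeff ξ (b k : H), innerCoeff η (b k : H)⟫_ℂ)
      ⟪η, amplify ι V.starProjection ξ⟫_ℂ := by
  have hs : Summable fun a : ι × κ => ⟪η a.1, (b a.2 : H)⟫_ℂ * ⟪(b a.2 : H), ξ a.1⟫_ℂ := by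
    refine Summable.of_norm_bounded
      ((b.summable_norm_inner_sq η).add (b.summable_norm_inner_sq ξ)) fun a => ?_
    rw [norm_mul, norm_inner_symm (b a.2 : H)]
    nlinarith [sq_nonneg (‖⟪η a.1, (b a.2 : H)⟫_ℂ‖ - ‖⟪ξ a.1, (b a.2 : H)⟫_ℂ‖),
      sq_nonneg ‖⟪η a.1, (b a.2 : H)⟫_ℂ‖, sq_nonneg ‖⟪ξ a.1, (b a.2 : H)⟫_ℂ‖]
  have h1 := hs.hasSum.prod_fiberwise fun i =>
    b.hasSum_inner_mul_inner_starProjection (η i) (ξ i)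
  have h2 := h1.unique (lp.hasSum_inner (𝕜 := ℂ) η (amplify ι V.starProjection ξ))
  have h3 := (Equiv.prodComm κ ι).hasSum_iff.2 hs.hasSum
  rw [h2] at h3
  refine h3.prod_fiberwise fun k => ?_
  have := lp.hasSum_inner (𝕜 := ℂ) (innerCoeff ξ (b k : H)) (innerCoeff η (b k : H))
  simpa using this

theorem HilbertBasis.hasSum_norm_innerCoeff_sq (b : HilbertBasis κ ℂ V)
    (ξ : lp (fun _ : ι => H) 2) :
    HasSum (fun k => ‖innerCoeff ξ (b k : H)‖ ^ 2)
      (RCLike.re ⟪ξ, amplify ι V.starProjection ξ⟫_ℂ) := by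
  have h := Complex.hasSum_re (b.hasSum_inner_innerCoeff ξ ξ)
  refine h.congr_fun fun k => ?_
  exact (inner_self_eq_norm_sq (𝕜 := ℂ) _).symm

end Amplification

/-! ### Increments of projections and the estimate on one block -/

section Difference

variable {𝕜 E : Type*} [RCLike 𝕜] [NormedAddCommGroup E] [InnerProductSpace 𝕜 E]
  {U W : Submodule 𝕜 E}
  [U.HasOrthogonalProjection] [W.HasOrthogonalProjection]

/-- Along a chain of subspaces this makes the squared increments telescope. -/
theorem Submodule.norm_starProjection_sub_sq (h : U ≤ W) (x : E) :
    ‖W.starProjection x - U.starProjection x‖ ^ 2 =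
      ‖W.starProjection x‖ ^ 2 - ‖U.starProjection x‖ ^ 2 := by
  have h1 : RCLike.re ⟪W.starProjection x, U.starProjection x⟫_𝕜 = ‖U.starProjection x‖ ^ 2 := by
    rw [W.inner_starProjection_left_eq_right,
      Submodule.starProjection_eq_self_iff.2 (h (U.starProjection_apply_mem x)),
      ← U.inner_starProjection_left_eq_right, U.re_inner_starProjection_eq_normSq]
    rfl
  rw [norm_sub_sq (𝕜 := 𝕜), h1]
  ring

theorem Submodule.norm_starProjection_sub_le (h : U ≤ W) (x : E) :
    ‖W.starProjection x - U.starProjection x‖ ≤ ‖x‖ := by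
  refine le_of_sq_le_sq ?_ (norm_nonneg _)
  rw [Submodule.norm_starProjection_sub_sq h]
  have := pow_le_pow_left₀ (norm_nonneg _) (W.norm_starProjection_apply_le x) 2
  nlinarith [sq_nonneg ‖U.starProjection x‖]

end Difference

section Increment

variable {ι : Type*} {H : Type*} [NormedAddCommGroup H] [InnerProductSpace ℂ H]

theorem lp.norm_sub_sum_single_sq [DecidableEq ι] (x : lp (fun _ : ι => ℂ) 2) (m : Finset ι) :
    ‖x - ∑ i ∈ m, lp.single 2 i (x i)‖ ^ 2 = ‖x‖ ^ 2 - ∑ i ∈ m, ‖x i‖ ^ 2 := by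
  simpa using lp.norm_compl_sum_single (by norm_num) x m

/-- Only the component of x in W ⊖ U meets y. The coordinates in m are bounded through the
increments on the unit vectors, the tail by its norm, and the product by the weighted inequality of
means. The right side is additive in squares, so it can be summed over a basis and over a chain of
intervals. -/
theorem norm_inner_le_of_mem_of_mem_orthogonal [DecidableEq ι]
    {U W : Submodule ℂ (lp (fun _ : ι => ℂ) 2)}
    [U.HasOrthogonalProjection] [W.HasOrthogonalProjection] (h : U ≤ W)
    {x y : lp (fun _ : ι => ℂ) 2} (hx : x ∈ W) (hy : y ∈ Uᗮ) (m : Finset ι) {t : ℝ} (ht : 0 < t) :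
    ‖⟪x, y⟫_ℂ‖ ≤ t * (2 * m.card * ∑ i ∈ m, ‖x i‖ ^ 2 *
        (‖W.starProjection (lp.single 2 i 1)‖ ^ 2 - ‖U.starProjection (lp.single 2 i 1)‖ ^ 2) +
      2 * (‖x‖ ^ 2 - ∑ i ∈ m, ‖x i‖ ^ 2)) + t⁻¹ * ‖y‖ ^ 2 := by
  set D := W.starProjection - U.starProjection with hD
  have hDle : ∀ z, ‖D z‖ ≤ ‖z‖ := Submodule.norm_starProjection_sub_le h
  have hxy : ⟪x, y⟫_ℂ = ⟪D x, y⟫_ℂ := by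
    rw [hD, sub_apply, inner_sub_left, hy _ (U.starProjection_apply_mem x),
      sub_zero, Submodule.starProjection_eq_self_iff.2 hx]
  have hm : ‖D (∑ i ∈ m, lp.single 2 i (x i))‖ ^ 2 ≤ m.card * ∑ i ∈ m, ‖x i‖ ^ 2 *
      (‖W.starProjection (lp.single 2 i 1)‖ ^ 2 - ‖U.starProjection (lp.single 2 i 1)‖ ^ 2) := by
    have h1 : ‖D (∑ i ∈ m, lp.single 2 i (x i))‖ ≤
        ∑ i ∈ m, ‖x i‖ * ‖D (lp.single 2 i 1)‖ := by
      rw [map_sum]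
      refine norm_sum_le_of_le _ fun i _ => ?_
      rw [← norm_smul, ← map_smul, ← lp.single_smul, smul_eq_mul, mul_one]
    refine (pow_le_pow_left₀ (norm_nonneg _) h1 2).trans ((sq_sum_le_card_mul_sum_sq).trans ?_)
    simp_rw [mul_pow, ← Submodule.norm_starProjection_sub_sq h]
    rfl
  have hx' : ‖D x‖ ≤ ‖D (∑ i ∈ m, lp.single 2 i (x i))‖ + ‖x - ∑ i ∈ m, lp.single 2 i (x i)‖ := by
    calc ‖D x‖ = ‖D (∑ i ∈ m, lp.single 2 i (x i)) + D (x - ∑ i ∈ m, lp.single 2 i (x i))‖ := by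
          rw [← map_add, add_sub_cancel]
      _ ≤ _ := (norm_add_le _ _).trans (by gcongr; exact hDle _)
  have hsq := lp.norm_sub_sum_single_sq x m
  have hDx : ‖D x‖ ^ 2 ≤ 2 * ‖D (∑ i ∈ m, lp.single 2 i (x i))‖ ^ 2 +
      2 * ‖x - ∑ i ∈ m, lp.single 2 i (x i)‖ ^ 2 :=
    (pow_le_pow_left₀ (norm_nonneg _) hx' 2).trans (by
      nlinarith [sq_nonneg (‖D (∑ i ∈ m, lp.single 2 i (x i))‖ -
        ‖x - ∑ i ∈ m, lp.single 2 i (x i)‖)])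
  have hamgm : ‖D x‖ * ‖y‖ ≤ t * ‖D x‖ ^ 2 + t⁻¹ * ‖y‖ ^ 2 := by
    have h1 : 0 ≤ t * (‖D x‖ - t⁻¹ * ‖y‖) ^ 2 := by positivity
    have h2 : t * (‖D x‖ - t⁻¹ * ‖y‖) ^ 2 =
        t * ‖D x‖ ^ 2 - 2 * (‖D x‖ * ‖y‖) + t⁻¹ * ‖y‖ ^ 2 := by
      field_simp
      ring
    have h3 : 0 ≤ ‖D x‖ * ‖y‖ := by positivity
    linarith
  rw [hxy]
  refine (norm_inner_le_norm _ _).trans (hamgm.trans ?_)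
  gcongr
  linarith

/-- The previous bound is summed over an orthonormal basis of V; the coefficients of ξ i contribute
‖V ξ i‖² ≤ δ². -/
theorem norm_inner_amplify_le [DecidableEq ι] {V : Submodule ℂ H} [CompleteSpace V]
    {U W : Submodule ℂ (lp (fun _ : ι => ℂ) 2)}
    [U.HasOrthogonalProjection] [W.HasOrthogonalProjection] (h : U ≤ W)
    (ξ η : lp (fun _ : ι => H) 2) (hξ : ∀ f ∈ V, innerCoeff ξ f ∈ W)
    (hη : ∀ f ∈ V, innerCoeff η f ∈ Uᗮ) (m : Finset ι) {t δ : ℝ} (ht : 0 < t)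
    (hδ : ∀ i ∈ m, ‖V.starProjection (ξ i)‖ ≤ δ) :
    ‖⟪η, amplify ι V.starProjection ξ⟫_ℂ‖ ≤ t * (2 * m.card * (δ ^ 2 * ∑ i ∈ m,
        (‖W.starProjection (lp.single 2 i 1)‖ ^ 2 - ‖U.starProjection (lp.single 2 i 1)‖ ^ 2)) +
      2 * (RCLike.re ⟪ξ, amplify ι V.starProjection ξ⟫_ℂ -
        ∑ i ∈ m, ‖V.starProjection (ξ i)‖ ^ 2)) +
      t⁻¹ * RCLike.re ⟪η, amplify ι V.starProjection η⟫_ℂ := by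
  obtain ⟨w, b, -⟩ := exists_hilbertBasis ℂ V
  have h1 := b.hasSum_inner_innerCoeff ξ η
  have h2 : HasSum (fun k => t * (2 * m.card * ∑ i ∈ m, ‖innerCoeff ξ (b k : H) i‖ ^ 2 *
        (‖W.starProjection (lp.single 2 i 1)‖ ^ 2 - ‖U.starProjection (lp.single 2 i 1)‖ ^ 2) +
      2 * (‖innerCoeff ξ (b k : H)‖ ^ 2 - ∑ i ∈ m, ‖innerCoeff ξ (b k : H) i‖ ^ 2)) +
        t⁻¹ * ‖innerCoeff η (b k : H)‖ ^ 2) _ :=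
    ((((hasSum_sum fun i (_ : i ∈ m) => (b.hasSum_norm_inner_sq (ξ i)).mul_right _).mul_left
      (2 * m.card : ℝ)).add (((b.hasSum_norm_innerCoeff_sq ξ).sub
      (hasSum_sum fun i (_ : i ∈ m) => b.hasSum_norm_inner_sq (ξ i))).mul_left 2)).mul_left t).add
      ((b.hasSum_norm_innerCoeff_sq η).mul_left t⁻¹)
  refine (h1.norm_le_of_bounded h2 fun k =>
    norm_inner_le_of_mem_of_mem_orthogonal h (hξ _ (b k).2) (hη _ (b k).2) m ht).trans ?_
  gcongr
  rw [Finset.mul_sum]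
  refine Finset.sum_le_sum fun i hi => ?_
  refine mul_le_mul_of_nonneg_right (pow_le_pow_left₀ (norm_nonneg _) (hδ i hi) 2) ?_
  rw [← Submodule.norm_starProjection_sub_sq h]
  positivity

end Increment

/-! ### From rank one operators to the identity -/

namespace IsNest

variable {H : Type*} [NormedAddCommGroup H] [InnerProductSpace ℂ H] [CompleteSpace H]
  {N : Set (H →L[ℂ] H)}

/-- The difference of two members of a nest as a projection onto a closed subspace. -/
theorem exists_starProjection_eq_sub (hN : IsNest N) {p q : N} (h : p ≤ q) :
    ∃ (V : Submodule ℂ H) (_ : CompleteSpace V), V.starProjection = q.1 - p.1 ∧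
      ∀ f ∈ V, p.1 f = 0 ∧ q.1 f = f := by
  let V : Submodule ℂ H := (q.1 - p.1 - 1 : H →L[ℂ] H).ker
  have hVc : CompleteSpace V :=
    (q.1 - p.1 - 1 : H →L[ℂ] H).isClosed_ker.completeSpace_coe
  have hV : ∀ f ∈ V, p.1 f = 0 ∧ q.1 f = f := by
    intro f hf
    have hf1 : q.1 f - p.1 f = f := sub_eq_zero.1 hf
    have hp : p.1 f = 0 := by
      rw [← hf1, map_sub, hN.apply_of_le' h, hN.apply_apply, sub_self]
    exact ⟨hp, by rwa [hp, sub_zero] at hf1⟩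
  refine ⟨V, hVc, ContinuousLinearMap.ext fun x => ?_, hV⟩
  refine Submodule.eq_starProjection_of_mem_of_inner_eq_zero (K := V) ?_ fun w hw => ?_
  · refine sub_eq_zero.2 ?_
    simp [hN.apply_apply, hN.apply_of_le h, hN.apply_of_le' h]
  · obtain ⟨h1, h2⟩ := hV w hw
    rw [sub_apply, inner_sub_left, inner_sub_left, hN.inner_apply, hN.inner_apply, h1, h2]
    simp

variable {ι : Type*}

/-- The kernel of a nest member, seen through the coefficients of `ξ`. -/
noncomputable def coeffSpace (ξ : lp (fun _ : ι => H) 2) (p : N) :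
    Submodule ℂ (lp (fun _ : ι => ℂ) 2) :=
  ((p.1 : H →ₗ[ℂ] H).ker.map (innerCoeff ξ)).topologicalClosure

instance (ξ : lp (fun _ : ι => H) 2) (p : N) : CompleteSpace (coeffSpace ξ p) :=
  inferInstanceAs (CompleteSpace (Submodule.topologicalClosure _))

theorem coeffSpace_anti (hN : IsNest N) (ξ : lp (fun _ : ι => H) 2) {p q : N} (h : p ≤ q) :
    coeffSpace ξ q ≤ coeffSpace ξ p :=
  Submodule.topologicalClosure_mono (Submodule.map_mono fun _ hx => hN.eq_zero_of_le h hx)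

omit [CompleteSpace H] in
theorem innerCoeff_mem_coeffSpace (ξ : lp (fun _ : ι => H) 2) {p : N} {u : H} (hu : p.1 u = 0) :
    innerCoeff ξ u ∈ coeffSpace ξ p :=
  Submodule.le_topologicalClosure _ ⟨u, hu, rfl⟩

omit [CompleteSpace H] in
theorem innerCoeff_mem_coeffSpace_orthogonal (ξ η : lp (fun _ : ι => H) 2) {p : N} {v : H}
    (h : ∀ u, p.1 u = 0 → ⟪innerCoeff ξ u, innerCoeff η v⟫_ℂ = 0) :
    innerCoeff η v ∈ (coeffSpace ξ p)ᗮ := by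
  rw [coeffSpace, Submodule.orthogonal_closure]
  rintro _ ⟨u, hu, rfl⟩
  exact h u hu

theorem norm_sub_apply_sq (hN : IsNest N) {p q : N} (h : p ≤ q) (x : H) :
    ‖q.1 x - p.1 x‖ ^ 2 = ‖q.1 x‖ ^ 2 - ‖p.1 x‖ ^ 2 := by
  have h1 : ⟪q.1 x, p.1 x⟫_ℂ = ⟪p.1 x, p.1 x⟫_ℂ := by
    rw [hN.inner_apply, hN.apply_of_le h, hN.inner_apply, hN.apply_apply]
  rw [norm_sub_sq (𝕜 := ℂ), h1, inner_self_eq_norm_sq]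
  ring

theorem amplify_top (hN : IsNest N) (ξ : lp (fun _ : ι => H) 2) :
    amplify ι hN.top.1 ξ = ξ := rfl

theorem amplify_bot (hN : IsNest N) (ξ : lp (fun _ : ι => H) 2) :
    amplify ι hN.bot.1 ξ = 0 := rfl

/-- The condition on p and q covers both p = q and a gap of the nest. The bound is carried up the
nest by induction. The δ² terms do not grow with the number of intervals, since the increments on
each unit vector total at most 1. -/
theorem norm_inner_le_of_forall_inner_innerCoeff_eq_zero [DecidableEq ι] (hN : IsNest N)
    (ξ η : lp (fun _ : ι => H) 2)
    (h : ∀ p q : N, (∀ r : N, r ≤ p ∨ q ≤ r) → ∀ u v, p.1 u = 0 → q.1 v = v →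
      ⟪innerCoeff ξ u, innerCoeff η v⟫_ℂ = 0) (m : Finset ι) {t δ : ℝ} (ht : 0 < t) (hδ : 0 < δ) :
    ‖⟪η, ξ⟫_ℂ‖ ≤ t * (2 * m.card * (δ ^ 2 * m.card) + 2 * (‖ξ‖ ^ 2 - ∑ i ∈ m, ‖ξ i‖ ^ 2)) +
      t⁻¹ * ‖η‖ ^ 2 := by
  classical
  let Q : N → ι → ℝ := fun p i => ‖(coeffSpace ξ p).starProjection (lp.single 2 i 1)‖ ^ 2
  -- A running bound whose increment over an interval is exactly the estimate for that block.
  let B : N → ℝ := fun p => t * (2 * m.card * (δ ^ 2 * ∑ i ∈ m, (1 - Q p i)) +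
      2 * (RCLike.re ⟪ξ, amplify ι p.1 ξ⟫_ℂ - ∑ i ∈ m, ‖p.1 (ξ i)‖ ^ 2)) +
      t⁻¹ * RCLike.re ⟪η, amplify ι p.1 η⟫_ℂ
  have hQ1 : ∀ p i, Q p i ≤ 1 := fun p i => by
    have := Submodule.norm_starProjection_apply_le (coeffSpace ξ p) (lp.single 2 i (1 : ℂ))
    rw [lp.norm_single (by norm_num), norm_one] at this
    exact pow_le_one₀ (norm_nonneg _) this
  have hQ0 : ∀ p i, 0 ≤ Q p i := fun p i => sq_nonneg _
  have main : ‖⟪η, amplify ι hN.top.1 ξ⟫_ℂ‖ ≤ B hN.top := by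
    refine hN.induction (P := fun p => ‖⟪η, amplify ι p.1 ξ⟫_ℂ‖ ≤ B p) (m.image ξ) hδ ?_ ?_
    · have : 0 ≤ ∑ i ∈ m, (1 - Q hN.bot i) :=
        Finset.sum_nonneg fun i _ => sub_nonneg.2 (hQ1 _ i)
      have h0 : ∑ i ∈ m, ‖hN.bot.1 (ξ i)‖ ^ 2 = 0 :=
        Finset.sum_eq_zero fun i _ => by simp [bot]
      simp only [B, amplify_bot, h0]
      simp only [inner_zero_right, norm_zero, map_zero, sub_zero, mul_zero, add_zero]
      positivity
    · intro p q hpq hp hstep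
      obtain ⟨V, _, hV, hVf⟩ := hN.exists_starProjection_eq_sub hpq
      have hle := hN.coeffSpace_anti ξ hpq
      have hξ : ∀ f ∈ V, innerCoeff ξ f ∈ coeffSpace ξ p := fun f hf =>
        innerCoeff_mem_coeffSpace ξ (hVf f hf).1
      have hη : ∀ f ∈ V, innerCoeff η f ∈ (coeffSpace ξ q)ᗮ := fun f hf =>
        innerCoeff_mem_coeffSpace_orthogonal ξ η fun u hu =>
          h q q (hN.le_total · q) u f hu (hVf f hf).2
      have hB : B q - B p = t * (2 * m.card * (δ ^ 2 * ∑ i ∈ m, (Q p i - Q q i)) +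
          2 * (RCLike.re ⟪ξ, amplify ι V.starProjection ξ⟫_ℂ -
            ∑ i ∈ m, ‖V.starProjection (ξ i)‖ ^ 2)) +
          t⁻¹ * RCLike.re ⟪η, amplify ι V.starProjection η⟫_ℂ := by
        simp only [B, hV, amplify_sub, inner_sub_right, map_sub, sub_apply,
          hN.norm_sub_apply_sq hpq, Finset.sum_sub_distrib]
        ring
      have hsplit : ‖⟪η, amplify ι q.1 ξ⟫_ℂ‖ ≤ ‖⟪η, amplify ι p.1 ξ⟫_ℂ‖ +
          ‖⟪η, amplify ι V.starProjection ξ⟫_ℂ‖ := by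
        refine le_trans (le_of_eq ?_) (norm_add_le _ _)
        rw [hV, amplify_sub, inner_sub_right, add_sub_cancel]
      suffices ‖⟪η, amplify ι V.starProjection ξ⟫_ℂ‖ ≤ B q - B p by linarith
      rw [hB]
      rcases hstep with hgap | hsmall
      -- Across a gap the hypothesis kills every term of the block, so only B p ≤ B q is needed.
      · obtain ⟨w, b, -⟩ := exists_hilbertBasis ℂ V
        have h1 := b.hasSum_inner_innerCoeff ξ η
        have h2 : ⟪η, amplify ι V.starProjection ξ⟫_ℂ = 0 := by
          refine h1.unique ?_
          convert hasSum_zero using 2 with k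
          exact h p q hgap _ _ (hVf _ (b k).2).1 (hVf _ (b k).2).2
        have h3 : 0 ≤ ∑ i ∈ m, (Q p i - Q q i) := Finset.sum_nonneg fun i _ => by
          simp only [Q]
          rw [← Submodule.norm_starProjection_sub_sq hle]
          positivity
        have h4 : 0 ≤ RCLike.re ⟪ξ, amplify ι V.starProjection ξ⟫_ℂ -
            ∑ i ∈ m, ‖V.starProjection (ξ i)‖ ^ 2 := by
          rw [sub_nonneg]
          refine hasSum_le (f := fun k => ∑ i ∈ m, ‖⟪ξ i, (b k : H)⟫_ℂ‖ ^ 2) (fun k => ?_)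
            (hasSum_sum fun i _ => b.hasSum_norm_inner_sq (ξ i)) (b.hasSum_norm_innerCoeff_sq ξ)
          exact sum_le_hasSum m (fun _ _ => sq_nonneg _) (lp.hasSum_norm_sq (innerCoeff ξ (b k : H)))
        have h5 : 0 ≤ RCLike.re ⟪η, amplify ι V.starProjection η⟫_ℂ :=
          (b.hasSum_norm_innerCoeff_sq η).nonneg fun _ => sq_nonneg _
        rw [h2, norm_zero]
        positivity
      · refine norm_inner_amplify_le hle ξ η hξ hη m ht fun i hi => ?_
        rw [hV]
        exact (hsmall _ (Finset.mem_image_of_mem _ hi)).le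
  refine main.trans ?_
  simp only [B, amplify_top, inner_self_eq_norm_sq]
  have hsum : ∑ i ∈ m, (1 - Q hN.top i) ≤ m.card := by
    simpa using Finset.sum_le_sum fun i (_ : i ∈ m) => sub_le_self 1 (hQ0 hN.top i)
  gcongr
  exact le_of_eq rfl

/-- If the functional of the pair `(ξ, η)` vanishes on the rank one operators in the nest algebra,
then it vanishes on the identity. -/
theorem inner_eq_zero_of_forall_inner_innerCoeff_eq_zero (hN : IsNest N)
    (ξ η : lp (fun _ : ι => H) 2)
    (h : ∀ p q : N, (∀ r : N, r ≤ p ∨ q ≤ r) → ∀ u v, p.1 u = 0 → q.1 v = v →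
      ⟪innerCoeff ξ u, innerCoeff η v⟫_ℂ = 0) : ⟪η, ξ⟫_ℂ = 0 := by
  classical
  have hb := hN.norm_inner_le_of_forall_inner_innerCoeff_eq_zero ξ η h
  -- The order of limits matters: δ → 0 with m fixed, then m exhausts ι, then t → ∞.
  have h1 : ∀ t > 0, ∀ m : Finset ι, ‖⟪η, ξ⟫_ℂ‖ ≤
      t * (2 * (‖ξ‖ ^ 2 - ∑ i ∈ m, ‖ξ i‖ ^ 2)) + t⁻¹ * ‖η‖ ^ 2 := by
    intro t ht m
    have hc : Continuous fun δ : ℝ => t * (2 * m.card * (δ ^ 2 * m.card) +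
      2 * (‖ξ‖ ^ 2 - ∑ i ∈ m, ‖ξ i‖ ^ 2)) + t⁻¹ * ‖η‖ ^ 2 := by fun_prop
    refine ge_of_tendsto (x := 𝓝[>] (0 : ℝ)) (f := fun δ : ℝ => t * (2 * m.card * (δ ^ 2 * m.card) +
      2 * (‖ξ‖ ^ 2 - ∑ i ∈ m, ‖ξ i‖ ^ 2)) + t⁻¹ * ‖η‖ ^ 2) ?_ ?_
    · simpa using (hc.tendsto 0).mono_left nhdsWithin_le_nhds
    · exact Filter.eventually_of_mem self_mem_nhdsWithin fun δ hδ => hb m ht hδ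
  have h2 : ∀ t > 0, ‖⟪η, ξ⟫_ℂ‖ ≤ t⁻¹ * ‖η‖ ^ 2 := by
    intro t ht
    have hs : Filter.Tendsto (fun m : Finset ι => ∑ i ∈ m, ‖ξ i‖ ^ 2) Filter.atTop
        (𝓝 (‖ξ‖ ^ 2)) := by
      simpa [HasSum] using lp.hasSum_norm_sq ξ
    have hlim := (((hs.const_sub (‖ξ‖ ^ 2)).const_mul 2).const_mul t).add_const
      (t⁻¹ * ‖η‖ ^ 2)
    rw [sub_self, mul_zero, mul_zero, zero_add] at hlim
    exact ge_of_tendsto' hlim (h1 t ht)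
  have h3 : Filter.Tendsto (fun t : ℝ => t⁻¹ * ‖η‖ ^ 2) Filter.atTop (𝓝 0) := by
    simpa using tendsto_inv_atTop_zero.mul_const (‖η‖ ^ 2)
  exact norm_le_zero_iff.1 (ge_of_tendsto h3
    ((Filter.eventually_gt_atTop 0).mono fun t ht => h2 t ht))

end IsNest

/-! ### Nest homomorphisms and rank one members of `Op` -/

namespace IsNest

variable {H : Type*} [NormedAddCommGroup H] [InnerProductSpace ℂ H] [CompleteSpace H]
  {N : Set (H →L[ℂ] H)}

theorem exists_ne_zero_of_lt (hN : IsNest N) {p q : N} (h : p < q) :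
    ∃ k ≠ 0, p.1 k = 0 ∧ q.1 k = k := by
  by_contra! hc
  refine h.not_ge (hN.le_of_fixed fun x hx => ?_)
  by_contra hne
  refine hc (x - p.1 x) (sub_ne_zero.2 (Ne.symm hne)) ?_ ?_
  · rw [map_sub, hN.apply_apply, sub_self]
  · rw [map_sub, hx, hN.apply_of_le h.le]

theorem mem_closure_wotOn_Iio (hN : IsNest N) {p : N} (hne : (Set.Iio p).Nonempty)
    (hp : IsLUB (Set.Iio p) p) : p ∈ closure[wotOn N] (Set.Iio p) := by
  obtain ⟨r₀, hr₀⟩ := hne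
  have : Nonempty (Set.Iio p) := ⟨⟨r₀, hr₀⟩⟩
  have : IsDirected (Set.Iio p) (· ≤ ·) := ⟨fun a b => (hN.le_total a.1 b.1).elim
    (fun h => ⟨b, h, le_rfl⟩) (fun h => ⟨a, le_rfl, h⟩)⟩
  have key : Filter.Tendsto (fun r : Set.Iio p => r.1) Filter.atTop (@nhds _ (wotOn N) p) := by
    rw [nhds_induced, Filter.tendsto_comap_iff,
      ContinuousLinearMapWOT.tendsto_iff_forall_inner_apply_tendsto]
    intro x y
    refine ((innerSL ℂ y).continuous.tendsto (p.1 x)).comp (Metric.tendsto_nhds.2 fun ε hε => ?_)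
    obtain ⟨r, hr, hrx⟩ := hN.exists_mem_forall_norm_lt_of_isLUB ⟨r₀, hr₀⟩ hp {x} hε
    refine (Filter.eventually_ge_atTop (⟨r, hr⟩ : Set.Iio p)).mono fun r' hr' => ?_
    rw [dist_comm, dist_eq_norm]
    exact (hN.norm_sub_apply_mono hr' r'.2.le le_rfl x).trans_lt (hrx x (Finset.mem_singleton_self x))
  let := wotOn N
  exact mem_closure_of_tendsto key (Filter.Eventually.of_forall fun r => r.2)

end IsNest

namespace IsContOntoNestHom

variable {H K R : Type*}
  [NormedAddCommGroup H] [InnerProductSpace ℂ H] [CompleteSpace H]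
  [NormedAddCommGroup K] [InnerProductSpace ℂ K] [CompleteSpace K]
  [NormedAddCommGroup R] [InnerProductSpace ℂ R] [CompleteSpace R]
  {N : Set (H →L[ℂ] H)} {M : Set (K →L[ℂ] K)} {L : Set (R →L[ℂ] R)}

theorem map_bot {φ : N → M} (hφ : IsContOntoNestHom φ) (hN : IsNest N) (hM : IsNest M) :
    φ hN.bot = hM.bot := by
  obtain ⟨n, hn⟩ := hφ.surjective hM.bot
  exact ((hφ.monotone (hN.bot_le n)).trans_eq hn).antisymm (hM.bot_le _)

omit [CompleteSpace H] [CompleteSpace K] [CompleteSpace R] in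
theorem comp {θ : M → L} {φ : N → M} (hθ : IsContOntoNestHom θ) (hφ : IsContOntoNestHom φ) :
    IsContOntoNestHom (θ ∘ φ) :=
  ⟨hθ.monotone.comp hφ.monotone, @Continuous.comp _ _ _ (wotOn N) (wotOn M) (wotOn L) _ _
    hθ.continuous hφ.continuous, hθ.surjective.comp hφ.surjective⟩

/-- A vector in the range of `φ p` is approximated by vectors that are fixed by every `φ r` with
`r` not below some member of the nest strictly below `p`. -/
theorem exists_lt_norm_sub_lt {φ : N → M} (hφ : IsContOntoNestHom φ) (hN : IsNest N)
    (hM : IsNest M) {p : N} (hp : p ≠ hN.bot) {w : K} (hw : (φ p).1 w = w) {ε : ℝ} (hε : 0 < ε) :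
    ∃ p' < p, ∃ w', ‖w - w'‖ < ε ∧ ∀ r, r ≤ p' ∨ (φ r).1 w' = w' := by
  obtain ⟨s, hs, -⟩ := hN.exists_isLUB (Set.Iio p)
  have hsp : s ≤ p := hs.2 fun r hr => le_of_lt hr
  -- If p has an immediate predecessor, w itself works. Otherwise p is a limit from below, and weak
  -- continuity of φ makes w' = φ(r) w close to w for some r < p.
  rcases hsp.lt_or_eq with h | rfl
  · refine ⟨s, h, w, by simpa using hε, fun r => ?_⟩
    by_cases hpr : p ≤ r
    · exact .inr (hM.fixed_of_le (hφ.monotone hpr) hw)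
    · exact .inl (hs.1 (hN.lt_of_not_ge hpr))
  · have hbot : hN.bot ∈ Set.Iio s := lt_of_le_of_ne (hN.bot_le s) hp.symm
    have hcl := hN.mem_closure_wotOn_Iio ⟨_, hbot⟩ hs
    have hcont : @Continuous _ _ (wotOn N) _ fun r => ⟪w, (φ r).1 w⟫_ℂ := by
      have h1 : @Continuous _ _ (wotOn M) _
          fun m : M => (ContinuousLinearMapWOT.ofCLM m.1 : K →WOT[ℂ] K) := continuous_induced_dom
      exact @Continuous.comp _ _ _ (wotOn N) (wotOn M) _ _ _
        (@Continuous.comp _ _ _ (wotOn M) _ _ _ _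
          (ContinuousLinearMapWOT.continuous_dual_apply w (innerSL ℂ w)) h1) hφ.continuous
    have himg : ⟪w, (φ s).1 w⟫_ℂ ∈ closure ((fun r => ⟪w, (φ r).1 w⟫_ℂ) '' Set.Iio s) := by
      let := wotOn N
      exact image_closure_subset_closure_image hcont ⟨s, hcl, rfl⟩
    obtain ⟨_, ⟨r, hr, rfl⟩, hd⟩ := Metric.mem_closure_iff.1 himg (ε ^ 2) (by positivity)
    refine ⟨r, hr, (φ r).1 w, ?_, fun r' => ?_⟩
    · have h2 : ‖w - (φ r).1 w‖ ^ 2 = RCLike.re (⟪w, w⟫_ℂ - ⟪w, (φ r).1 w⟫_ℂ) := by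
        have h3 : ⟪(φ r).1 w, (φ r).1 w⟫_ℂ = ⟪w, (φ r).1 w⟫_ℂ := by
          rw [hM.inner_apply, hM.apply_apply]
        rw [norm_sub_sq (𝕜 := ℂ), ← inner_self_eq_norm_sq (𝕜 := ℂ) ((φ r).1 w), h3, map_sub,
          inner_self_eq_norm_sq]
        ring
      refine lt_of_pow_lt_pow_left₀ 2 hε.le ?_
      rw [h2]
      simp only [hw] at hd
      rw [dist_eq_norm] at hd
      exact (RCLike.re_le_norm _).trans_lt hd
    · by_cases h : r ≤ r'
      · exact .inr (hM.apply_of_le (hφ.monotone h) w)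
      · exact .inl (hN.lt_of_not_ge h).le

omit [CompleteSpace H] [CompleteSpace K] in
theorem _root_.rankOne_mem_Op {φ : N → M} {w : K} {u : H}
    (h : ∀ r, (∀ z, ⟪u, r.1 z⟫_ℂ = 0) ∨ (φ r).1 w = w) :
    InnerProductSpace.rankOne ℂ w u ∈ Op φ := by
  intro r
  ext z
  rcases h r with h | h
  · simp [h z]
  · simp [h]

omit [CompleteSpace K] in
theorem _root_.rankOne_mem_Op_of_le {φ : N → M} (hN : IsNest N) {w : K} {u : H} {p : N}
    (hu : p.1 u = 0) (h : ∀ r, r ≤ p ∨ (φ r).1 w = w) :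
    InnerProductSpace.rankOne ℂ w u ∈ Op φ :=
  rankOne_mem_Op fun r => (h r).imp_left fun hr z => by
    rw [← hN.inner_apply, hN.eq_zero_of_le hr hu, inner_zero_left]

omit [CompleteSpace H] [CompleteSpace K] in
theorem _root_.apply_eq_of_mem_Op {φ : N → M} {T : H →L[ℂ] K} (hT : T ∈ Op φ) {p : N} {v : H}
    (hv : p.1 v = v) : (φ p).1 (T v) = T v := by
  have := DFunLike.congr_fun (hT p) v
  simp only [ContinuousLinearMap.comp_apply, sub_apply, hv] at this
  exact (sub_eq_zero.1 this).symm

/-- Otherwise some k ≠ 0 lies in ran φ(p) and is killed by ψ(p). A rank one member of Op(φ) forces a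
vector w with ‖k - w‖ < ‖k‖ into ran ψ(p), yet k is at distance ‖k‖ from that range. -/
theorem le_of_Op_subset {φ ψ : N → M} (hφ : IsContOntoNestHom φ) (hN : IsNest N) (hM : IsNest M)
    (h : Op φ ⊆ Op ψ) (p : N) : φ p ≤ ψ p := by
  by_contra hc
  obtain ⟨k, hk, hψk, hφk⟩ := hM.exists_ne_zero_of_lt (hM.lt_of_not_ge hc)
  have hp : p ≠ hN.bot := by
    rintro rfl
    rw [hφ.map_bot hN hM] at hφk
    exact hk hφk.symm
  obtain ⟨p', hp', w, hw, hr⟩ := hφ.exists_lt_norm_sub_lt hN hM hp hφk (norm_pos_iff.2 hk)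
  obtain ⟨u, hu, hpu', hpu⟩ := hN.exists_ne_zero_of_lt hp'
  have hmem := apply_eq_of_mem_Op (h (rankOne_mem_Op_of_le hN hpu' hr)) hpu
  rw [InnerProductSpace.rankOne_apply, map_smul] at hmem
  have hfix : (ψ p).1 w = w := smul_right_injective _ (inner_self_ne_zero.2 hu) hmem
  have := hM.norm_sub_apply_le (ψ p) (k - w)
  rw [map_sub, hψk, hfix, zero_sub, sub_neg_eq_add, sub_add_cancel] at this
  exact this.not_gt hw

theorem Op_injective {φ ψ : N → M} (hφ : IsContOntoNestHom φ) (hψ : IsContOntoNestHom ψ)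
    (hN : IsNest N) (hM : IsNest M) (h : Op φ = Op ψ) : φ = ψ :=
  funext fun p => (hφ.le_of_Op_subset hN hM h.subset p).antisymm
    (hψ.le_of_Op_subset hN hM h.symm.subset p)

/-- The products of the elements of two sets of operators. -/
abbrev _root_.opProducts (Y : Set (K →L[ℂ] R)) (X : Set (H →L[ℂ] K)) : Set (H →L[ℂ] R) :=
  {z | ∃ y ∈ Y, ∃ x ∈ X, z = y ∘L x}

/-- Up to the factor ⟪k, k⟫, w'⊗u is the product of w'⊗k ∈ Op(θ) and k⊗u ∈ Op(φ), where k lies in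
ran φ(q) and is killed by some m < φ(q). Letting w' → w costs only a norm closure. -/
theorem rankOne_mem_closure_span {θ : M → L} {φ : N → M} (hθ : IsContOntoNestHom θ)
    (hφ : IsContOntoNestHom φ) (hN : IsNest N) (hM : IsNest M) (hL : IsNest L) {p q : N}
    (hpq : ∀ r, r ≤ p ∨ q ≤ r) {u : H} (hu : p.1 u = 0) {w : R} (hw : (θ (φ q)).1 w = w) :
    InnerProductSpace.rankOne ℂ w u ∈
      (Submodule.span ℂ (opProducts (Op θ) (Op φ))).topologicalClosure := by
  by_cases hq : φ q = hM.bot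
  · rw [hq, hθ.map_bot hM hL] at hw
    obtain rfl : (0 : R) = w := hw
    simp
  have hcl : w ∈ closure {w' | InnerProductSpace.rankOne ℂ w' u ∈
      Submodule.span ℂ (opProducts (Op θ) (Op φ))} := by
    refine Metric.mem_closure_iff.2 fun ε hε => ?_
    obtain ⟨m, hm, w', hw', hr⟩ := hθ.exists_lt_norm_sub_lt hM hL hq hw hε
    obtain ⟨k, hk, hmk, hqk⟩ := hM.exists_ne_zero_of_lt hm
    refine ⟨w', ?_, by rwa [dist_eq_norm]⟩
    have hy : InnerProductSpace.rankOne ℂ k u ∈ Op φ :=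
      rankOne_mem_Op_of_le hN hu fun r => (hpq r).imp_right fun h =>
        hM.fixed_of_le (hφ.monotone h) hqk
    have hx : InnerProductSpace.rankOne ℂ w' k ∈ Op θ := rankOne_mem_Op_of_le hM hmk hr
    have hprod := Submodule.smul_mem _ (⟪k, k⟫_ℂ)⁻¹
      (Submodule.subset_span (R := ℂ) (s := opProducts (Op θ) (Op φ)) ⟨_, hx, _, hy, rfl⟩)
    rwa [InnerProductSpace.rankOne_comp_rankOne, smul_smul,
      inv_mul_cancel₀ (inner_self_ne_zero.2 hk), one_smul] at hprod
  have hcont : Continuous fun w' : R => InnerProductSpace.rankOne ℂ w' u :=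
    (ContinuousLinearMap.smulRightL ℂ H R (innerSL ℂ u)).continuous
  exact map_mem_closure (f := fun w' : R => InnerProductSpace.rankOne ℂ w' u) hcont hcl fun _ h => h

end IsContOntoNestHom

universe u v

/-! ### The w*-topology through amplifications -/

section WStar

variable {H : Type u} {R : Type v}
  [NormedAddCommGroup H] [InnerProductSpace ℂ H] [NormedAddCommGroup R] [InnerProductSpace ℂ R]

/-- Evaluation of amplified operators at a fixed square summable family. -/
noncomputable def amplifyEval {ι : Type*} (ξ : lp (fun _ : ι => H) 2) :
    (H →L[ℂ] R) →L[ℂ] lp (fun _ : ι => R) 2 :=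
  LinearMap.mkContinuous
    { toFun T := amplify ι T ξ
      map_add' _ _ := rfl
      map_smul' _ _ := rfl } ‖ξ‖ fun T => by
    rw [mul_comm]
    exact (amplify ι T).le_of_opNorm_le (lp.norm_mapCLM_le _ _ _ _) ξ

theorem continuous_wStar_tsum_inner {ξ : ℕ → H} {η : ℕ → R}
    (hξ : Summable fun n => ‖ξ n‖ ^ 2) (hη : Summable fun n => ‖η n‖ ^ 2) :
    @Continuous _ _ (wStarTopology H R) _ fun T : H →L[ℂ] R => ∑' n, ⟪η n, T (ξ n)⟫_ℂ :=
  continuous_iff_le_induced.2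
    (iInf_le_of_le ξ (iInf_le_of_le η (iInf_le_of_le hξ (iInf_le _ hη))))

theorem summable_norm_single_sq {E : Type*} [NormedAddCommGroup E] (z : E) :
    Summable fun n : ℕ => ‖(Pi.single 0 z : ℕ → E) n‖ ^ 2 :=
  summable_of_ne_finset_zero (s := {0}) fun n hn => by
    rw [Pi.single_eq_of_ne (by simpa using hn)]
    simp

theorem continuous_wStar_inner (x : H) (y : R) :
    @Continuous _ _ (wStarTopology H R) _ fun T : H →L[ℂ] R => ⟪y, T x⟫_ℂ := by
  have h := continuous_wStar_tsum_inner (summable_norm_single_sq x) (summable_norm_single_sq y)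
  convert h using 2 with T
  rw [tsum_eq_single 0 fun n hn => by simp [Pi.single_eq_of_ne hn]]
  simp

/-- An operator is in the `w*`-closure of a set as soon as its amplifications can be approximated
at every square summable family. -/
theorem mem_closure_wStar {S : Set (H →L[ℂ] R)} {T : H →L[ℂ] R}
    (h : ∀ (ι : Type u) (ξ : lp (fun _ : ι => H) 2),
      amplify ι T ξ ∈ closure ((fun Z => amplify ι Z ξ) '' S)) :
    T ∈ closure[wStarTopology H R] S := by
  classical
  let F : Type u := {ξ : ℕ → H // Summable fun n => ‖ξ n‖ ^ 2}
  have key : ∀ a : Finset F × ℕ, ∃ Z ∈ S, ∀ ξ ∈ a.1, ∀ ζ : lp (fun _ : ℕ => H) 2, ⇑ζ = ξ.1 →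
      ‖amplify ℕ (Z - T) ζ‖ ≤ 1 / ((a.2 : ℝ) + 1) := by
    rintro ⟨J, n⟩
    -- Finitely many square summable sequences are concatenated into one family indexed by J × ℕ, so
    -- a single Z serves them all.
    have hmem : Memℓp (fun a : J × ℕ => a.1.1.1 a.2) 2 := by
      refine memℓp_gen ?_
      simp only [ENNReal.toReal_ofNat, Real.rpow_ofNat]
      exact (summable_prod_of_nonneg fun _ => by positivity).2
        ⟨fun j => j.1.2, Summable.of_finite⟩
    let Ξ : lp (fun _ : J × ℕ => H) 2 := ⟨_, hmem⟩
    obtain ⟨_, ⟨Z, hZ, rfl⟩, hd⟩ := Metric.mem_closure_iff.1 (h (J × ℕ) Ξ) (1 / ((n : ℝ) + 1))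
      (by positivity)
    refine ⟨Z, hZ, fun ξ hξ ζ hζ => ?_⟩
    rw [dist_comm, dist_eq_norm, ← amplify_sub] at hd
    refine le_trans (le_of_sq_le_sq ?_ (norm_nonneg _)) hd.le
    refine hasSum_le_inj (fun k : ℕ => ((⟨ξ, hξ⟩, k) : J × ℕ)) (fun a b hab => (Prod.ext_iff.1 hab).2)
      (fun _ _ => sq_nonneg _) (fun k => ?_) (lp.hasSum_norm_sq _) (lp.hasSum_norm_sq _)
    simp only [amplify_apply, hζ]
    rfl
  choose Z hZ hZ' using key
  have hlim : Filter.Tendsto Z Filter.atTop (@nhds _ (wStarTopology H R) T) := by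
    simp only [nhds_iInf, Filter.tendsto_iInf, nhds_induced, Filter.tendsto_comap_iff]
    intro ξ η hξ hη
    let ξ' : lp (fun _ : ℕ => H) 2 := ⟨ξ, memℓp_gen (by simpa using hξ)⟩
    let η' : lp (fun _ : ℕ => R) 2 := ⟨η, memℓp_gen (by simpa using hη)⟩
    have hf : ∀ A : H →L[ℂ] R, ∑' n, ⟪η n, A (ξ n)⟫_ℂ = ⟪η', amplify ℕ A ξ'⟫_ℂ := fun A =>
      (lp.inner_eq_tsum η' (amplify ℕ A ξ')).symm
    refine tendsto_iff_norm_sub_tendsto_zero.2 ?_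
    have h0 : Filter.Tendsto (fun a : Finset F × ℕ => ‖η'‖ * (1 / ((a.2 : ℝ) + 1)))
        Filter.atTop (𝓝 0) := by
      have h1 := (tendsto_one_div_add_atTop_nhds_zero_nat (𝕜 := ℝ)).const_mul ‖η'‖
      rw [mul_zero] at h1
      rw [← Filter.prod_atTop_atTop_eq]
      exact h1.comp Filter.tendsto_snd
    refine squeeze_zero' (Filter.Eventually.of_forall fun _ => norm_nonneg _) ?_ h0
    refine (Filter.eventually_ge_atTop (({⟨ξ, hξ⟩}, 0) : Finset F × ℕ)).mono fun a ha => ?_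
    simp only [Function.comp_apply, hf]
    rw [← inner_sub_right, ← amplify_sub]
    refine (norm_inner_le_norm _ _).trans ?_
    gcongr
    exact hZ' a ⟨ξ, hξ⟩ (ha.1 (Finset.mem_singleton_self _)) ξ' rfl
  let := wStarTopology H R
  exact mem_closure_of_tendsto hlim (Filter.Eventually.of_forall hZ)

end WStar

/-! ### The product formula and the equivalence -/

section Main

variable {H : Type*} {K : Type*} {R : Type*}
  [NormedAddCommGroup H] [InnerProductSpace ℂ H] [CompleteSpace H]
  [NormedAddCommGroup K] [InnerProductSpace ℂ K] [CompleteSpace K]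
  [NormedAddCommGroup R] [InnerProductSpace ℂ R] [CompleteSpace R]
  {N : Set (H →L[ℂ] H)} {M : Set (K →L[ℂ] K)} {L : Set (R →L[ℂ] R)}

omit [CompleteSpace H] in
-- `Op ζ` is cut out by the vanishing of w*-continuous vector functionals.
theorem Op.isClosed_wStar (ζ : N → L) (hL : IsNest L) :
    @IsClosed _ (wStarTopology H R) (Op ζ) := by
  let := wStarTopology H R
  have h : Op ζ = ⋂ (p : N) (x : H) (y : R),
      {T | ⟪y - (ζ p).1 y, T (p.1 x)⟫_ℂ = 0} := by
    ext T
    simp only [Op, Set.mem_iInter, Set.mem_ofPred_eq]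
    refine forall_congr' fun p => ⟨fun hT x y => ?_, fun hT => ?_⟩
    · have := DFunLike.congr_fun hT x
      rw [inner_sub_left, hL.inner_apply, ← inner_sub_right]
      have h2 : T (p.1 x) - (ζ p).1 (T (p.1 x)) = 0 := this
      rw [h2, inner_zero_right]
    · ext x
      refine ext_inner_left ℂ fun y => ?_
      have := hT x y
      rw [inner_sub_left, hL.inner_apply, ← inner_sub_right] at this
      simpa using this
  rw [h]
  exact isClosed_iInter fun p => isClosed_iInter fun x => isClosed_iInter fun y =>
    isClosed_eq (continuous_wStar_inner _ _) continuous_const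

/-- `Op ζ` as a subspace. -/
def Op.submodule (ζ : N → L) : Submodule ℂ (H →L[ℂ] R) where
  carrier := Op ζ
  add_mem' {a b} ha hb p := by
    rw [ContinuousLinearMap.add_comp, ContinuousLinearMap.comp_add, ha p, hb p, add_zero]
  zero_mem' p := by simp
  smul_mem' c a ha p := by
    rw [ContinuousLinearMap.smul_comp, ContinuousLinearMap.comp_smul, ha p, smul_zero]

omit [CompleteSpace H] [CompleteSpace K] [CompleteSpace R] in
theorem span_opProducts_subset_Op (θ : M → L) (φ : N → M) :
    (Submodule.span ℂ (opProducts (Op θ) (Op φ)) : Set (H →L[ℂ] R)) ⊆ Op (θ ∘ φ) := by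
  refine (Submodule.span_le (p := Op.submodule (θ ∘ φ))).2 ?_
  rintro _ ⟨y, hy, x, hx, rfl⟩ p
  ext z
  have h1 : (φ p).1 (x (p.1 z)) = x (p.1 z) :=
    (sub_eq_zero.1 (DFunLike.congr_fun (hx p) z)).symm
  have h2 := DFunLike.congr_fun (hy (φ p)) (x (p.1 z))
  simp only [ContinuousLinearMap.comp_apply, h1] at h2
  exact h2

/-- `Op (θ ∘ φ)` is the `w*`-closed span of the products. -/
theorem Op_comp_eq {θ : M → L} {φ : N → M} (hθ : IsContOntoNestHom θ)
    (hφ : IsContOntoNestHom φ) (hN : IsNest N) (hM : IsNest M) (hL : IsNest L) :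
    Op (θ ∘ φ) = wStarClosedSpanMul (Op θ) (Op φ) := by
  refine Set.Subset.antisymm (fun T hT => mem_closure_wStar fun ι ξ => ?_) ?_
  · set P := Submodule.span ℂ (opProducts (Op θ) (Op φ)) with hP
    change _ ∈ (P.map (amplifyEval (R := R) ξ).toLinearMap).topologicalClosure
    -- The approximations form a subspace of a Hilbert space, so it suffices to test against each η
    -- orthogonal to it.
    rw [← Submodule.orthogonal_orthogonal_eq_closure]
    intro η hη
    let E : (H →L[ℂ] R) →L[ℂ] ℂ := innerSL ℂ η ∘L amplifyEval ξ
    have hE : ∀ A ∈ P.topologicalClosure, ⟪η, amplify ι A ξ⟫_ℂ = 0 := by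
      have : P.topologicalClosure ≤ E.ker :=
        Submodule.topologicalClosure_minimal _
          (fun A hA => (Submodule.mem_orthogonal' _ _).1 hη _ ⟨A, hA, rfl⟩) E.isClosed_ker
      exact fun A hA => this hA
    have hadj : ⟪η, amplify ι T ξ⟫_ℂ = ⟪amplify ι (ContinuousLinearMap.adjoint T) η, ξ⟫_ℂ := by
      simp [lp.inner_eq_tsum, ContinuousLinearMap.adjoint_inner_left]
    rw [hadj]
    -- Moving T to the other side as T*η makes the claim one about the identity; the rank one
    -- operators to be killed become (T v)⊗u, with T v ∈ ran θ(φ(q)) because T ∈ Op(θ∘φ).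
    refine hN.inner_eq_zero_of_forall_inner_innerCoeff_eq_zero _ _ fun p q hpq u v hu hv => ?_
    have := hE _ (hθ.rankOne_mem_closure_span hφ hN hM hL hpq hu (apply_eq_of_mem_Op hT hv))
    rw [lp.inner_eq_tsum] at this
    rw [inner_innerCoeff_innerCoeff, ← this]
    refine tsum_congr fun i => ?_
    simp [ContinuousLinearMap.adjoint_inner_left, inner_smul_right, mul_comm]
  · let := wStarTopology H R
    exact closure_minimal (span_opProducts_subset_Op θ φ) (Op.isClosed_wStar _ hL)

end Main

theorem lemma4 {H K R : Type*}
    [NormedAddCommGroup H] [InnerProductSpace ℂ H] [CompleteSpace H]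
    [NormedAddCommGroup K] [InnerProductSpace ℂ K] [CompleteSpace K]
    [NormedAddCommGroup R] [InnerProductSpace ℂ R] [CompleteSpace R]
    (N : Set (H →L[ℂ] H)) (M : Set (K →L[ℂ] K)) (L : Set (R →L[ℂ] R))
    (hN : IsNest N) (hM : IsNest M) (hL : IsNest L)
    (φ : N → M) (ζ : N → L) (θ : M → L)
    (hφ : IsContOntoNestHom φ) (hζ : IsContOntoNestHom ζ) (hθ : IsContOntoNestHom θ) :
    ζ = θ ∘ φ ↔ Op ζ = wStarClosedSpanMul (Op θ) (Op φ) := by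
  have h := Op_comp_eq hθ hφ hN hM hL
  refine ⟨fun hζφ => hζφ ▸ h, fun hOp => ?_⟩
  exact hζ.Op_injective (hθ.comp hφ) hN hL (hOp.trans h.symm)
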